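/- Let $\mathbb K\in\{\mathbb R,\mathbb C\}$, let $X,Y$ be separable Hilbert spaces over $\mathbb K$, let $d,m\ge 1$, let $\mathcal O\subset\mathbb R^d$ be open, let $S=L^2(\mathcal O;\mathbb K^m)$, and let $w_1,\dots,w_m\in L^2(\mathcal O;X)$ (the data). Let $$K:S\to X,\qquad Kf=\sum_{j=1}^m\int_{\mathcal O}f_j(t)\,w_j(t)\,dt ,$$ be the POD operator of the data, with singular value decomposition $Kf=\sum_{k\ge1}\sigma_k(f,f_k)_S\,\varphi_k$, where $\sigma_1\ge\sigma_2\ge\dots\ge0$ and where the $f_k\in S$ with $\sigma_k>0$ are orthonormal, as are the $\varphi_k\in X$ with $\sigma_k>0$. (If $K$ has finite rank, put $\sigma_k=0$ for $k>\operatorname{rank}K$; in all the sums below, the terms with $\sigma_k=0$ are $0$.) Put $s_X=\operatorname{rank}K\in\{0,1,2,\dots\}\cup\{\infty\}$. Let $L:\mathcal D(L)\subset X\to Y$ be a linear, possibly unbounded, operator such that $w_j(t)\in\mathcal D(L)$ for almost every $t$ and $Lw_j\in L^2(\mathcal O;Y)$ for each $j$, and such that for all $f\in S$ $$Kf\in\mathcal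 D(L)\quad\text{and}\quad LKf=\sum_{j=1}^m\int_{\mathcal O}f_j(t)\,Lw_j(t)\,dt .$$ Then $\varphi_k\in\mathcal D(L)$ whenever $\sigma_k>0$. For each integer $r\ge1$ with $\sigma_r>0$, let $\Pi_r^Xx=\sum_{k=1}^r(x,\varphi_k)_X\,\varphi_k$ be the orthogonal projection of $X$ onto $\operatorname{span}\{\varphi_k\}_{k=1}^r$, and let $\Pi_r^Y:Y\to Y$ be a bounded linear projection (not necessarily orthogonal) with range $\operatorname{span}\{L\varphi_k\}_{k=1}^r$. **Error formulas.** For every $r\ge1$ with $\sigma_r>0$, the functions whose norms appear on the left belong to $L^2(\mathcal O;Y)$, and $$\sum_{j=1}^m\|Lw_j-L\Pi_r^Xw_j\|^2_{L^2(\mathcal O;Y)}=\sum_{k>r}\sigma_k^2\,\|L\varphi_k\|_Y^2,\tag{1}$$ $$\sum_{j=1}^m\|Lw_j-\Pi_r^YLw_j\|^2_{L^2(\mathcal O;Y)}=\sum_{k>r}\sigma_k^2\,\|L\varphi_k-\Pi_r^YL\varphi_k\|_Y^2.\tag{2}$$ If moreover $L$ is injective, with inverse $L^{-1}:\mathcal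 R(L)\to\mathcal D(L)$, and either $s_X<\infty$ or $$L^{-1}\Pi_r^YLKf=\sum_{j=1}^m\int_{\mathcal O}f_j(t)\,L^{-1}\Pi_r^YLw_j(t)\,dt\quad\text{for all }f\in S,$$ then the functions $w_j-L^{-1}\Pi_r^YLw_j$ belong to $L^2(\mathcal O;X)$ and $$\sum_{j=1}^m\|w_j-L^{-1}\Pi_r^YLw_j\|^2_{L^2(\mathcal O;X)}=\sum_{k>r}\sigma_k^2\,\|\varphi_k-L^{-1}\Pi_r^YL\varphi_k\|_X^2.\tag{3}$$ **Convergence.** Suppose that $s_X=\infty$. Then, as $r\to\infty$: 1. the left-hand side of (1) tends to $0$; 2. if $\sup_r\|\Pi_r^Y\|<\infty$, then the left-hand side of (2) tends to $0$; 3. if $L$ is injective, $L^{-1}$ is bounded (there is $M$ with $\|L^{-1}y\|_X\le M\|y\|_Y$ for all $y\in\mathcal R(L)$) and $\sup_r\|\Pi_r^Y\|<\infty$, then the left-hand side of (3) tends to $0$; 4. if $L$ is injective and $\{L^{-1}\Pi_r^YL\}$ is uniformly bounded (there is $C$ with $\|L^{-1}\Pi_r^YLx\|_X\le C\|x\|_X$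 for all $r\ge1$ and all $x\in\mathcal D(L)$), then the left-hand side of (3) tends to $0$. -/

import Mathlib

open MeasureTheory Filter Topology
open scoped ENNReal

namespace POD

/-- Lebesgue measure on the set `O ⊆ ℝ^d`. -/
noncomputable abbrev leb {d : ℕ} (O : Set (EuclideanSpace ℝ (Fin d))) :
    Measure (EuclideanSpace ℝ (Fin d)) :=
  volume.restrict O

/-- The Bochner space `L²(O; V)`. -/
noncomputable abbrev L2 {d : ℕ} (O : Set (EuclideanSpace ℝ (Fin d))) (V : Type*) [NormedAddCommGroup V] :=
  Lp V 2 (leb O)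

/-- The space `S = L²(O; 𝕜^m)`. -/
noncomputable abbrev S (𝕜 : Type*) [RCLike 𝕜] (m : ℕ) {d : ℕ} (O : Set (EuclideanSpace ℝ (Fin d))) :=
  L2 O (EuclideanSpace 𝕜 (Fin m))

/-- The value `T x` of a partially defined linear operator, extended by `0` to the points `x`
outside the domain of `T`. -/
noncomputable def val {𝕜 : Type*} [RCLike 𝕜] {V W : Type*} [NormedAddCommGroup V] [Module 𝕜 V]
    [NormedAddCommGroup W] [Module 𝕜 W] (T : V →ₗ.[𝕜] W) (x : V) : W :=
  open scoped Classical in if h : x ∈ T.domain then T ⟨x, h⟩ else 0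

section Operator

variable {𝕜 : Type*} [RCLike 𝕜] {X : Type*} [NormedAddCommGroup X] [InnerProductSpace 𝕜 X]
variable {d m : ℕ} {O : Set (EuclideanSpace ℝ (Fin d))}

/-- The integrand in the definition of the POD operator is integrable. -/
theorem integrable_smul_data (w : Fin m → L2 O X) (f : S 𝕜 m O) (j : Fin m) :
    Integrable (fun t => f t j • w j t) (leb O) := by
  have h1 : MemLp (fun t => f t j) 2 (leb O) := by
    refine (Lp.memLp f).of_le ?_ (Eventually.of_forall fun t => PiLp.norm_apply_le (f t) j)
    exact (EuclideanSpace.proj (𝕜 := 𝕜) j).continuous.comp_aestronglyMeasurable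
      (Lp.aestronglyMeasurable f)
  exact memLp_one_iff_integrable.1 ((Lp.memLp (w j)).smul h1)

variable [NormedSpace ℝ X] [IsScalarTower ℝ 𝕜 X]

/-- The POD operator `K : S → X`, `K f = ∑ⱼ ∫_O fⱼ(t) wⱼ(t) dt`, of the data `w₁, …, w_m`. -/
noncomputable def podOperator (w : Fin m → L2 O X) : S 𝕜 m O →ₗ[𝕜] X where
  toFun f := ∑ j, ∫ t in O, f t j • w j t
  map_add' f g := by
    rw [← Finset.sum_add_distrib]
    refine Finset.sum_congr rfl fun j _ => ?_
    rw [← integral_add (integrable_smul_data w f j) (integrable_smul_data w g j)]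
    refine integral_congr_ae ?_
    filter_upwards [Lp.coeFn_add f g] with t ht
    have h : (f + g) t = f t + g t := ht
    rw [h, PiLp.add_apply, add_smul]
  map_smul' c f := by
    simp only [RingHom.id_apply]
    rw [Finset.smul_sum]
    refine Finset.sum_congr rfl fun j _ => ?_
    rw [← integral_smul]
    refine integral_congr_ae ?_
    filter_upwards [Lp.coeFn_smul c f] with t ht
    have h : (c • f) t = c • f t := ht
    rw [h, PiLp.smul_apply, smul_eq_mul, mul_smul]

/-- The number `s_X ∈ ℕ ∪ {∞}` of positive POD singular values of the data: the rank of the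
POD operator. -/
noncomputable def podRank (𝕜 : Type*) [RCLike 𝕜] {X : Type*} [NormedAddCommGroup X]
    [InnerProductSpace 𝕜 X] [NormedSpace ℝ X] [IsScalarTower ℝ 𝕜 X]
    {d m : ℕ} {O : Set (EuclideanSpace ℝ (Fin d))} (w : Fin m → L2 O X) : ℕ∞ :=
  Cardinal.toENat (LinearMap.rank (podOperator (𝕜 := 𝕜) w))

end Operator

/-- `(σ, f, φ)` is a singular value decomposition of `T`. Sequences are indexed from `0`, so the
`k`-th singular value of the usual numbering is `σ (k - 1)`. When `T` has finite rank the
singular values are continued by zeros; singular vectors that belong to a zero singular value are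
irrelevant and left arbitrary (an infinite orthonormal sequence need not exist). -/
structure IsSVD {𝕜 : Type*} [RCLike 𝕜] {V W : Type*}
    [NormedAddCommGroup V] [InnerProductSpace 𝕜 V] [NormedAddCommGroup W] [InnerProductSpace 𝕜 W]
    (T : V →ₗ[𝕜] W) (σ : ℕ → ℝ) (f : ℕ → V) (φ : ℕ → W) : Prop where
  nonneg : ∀ k, 0 ≤ σ k
  antitone : Antitone σ
  orthonormal_right : Orthonormal 𝕜 (fun k : {k : ℕ // 0 < σ k} => f k)
  orthonormal_left : Orthonormal 𝕜 (fun k : {k : ℕ // 0 < σ k} => φ k)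
  hasSum : ∀ g, HasSum (fun k => ((σ k : 𝕜) * inner 𝕜 (f k) g) • φ k) (T g)

/-- The projection `Π_r^X x = ∑_{k ≤ r} (x, φ_k) φ_k`; the first `r` modes are
`φ 0, …, φ (r - 1)`. -/
noncomputable def projX (𝕜 : Type*) [RCLike 𝕜] {X : Type*} [NormedAddCommGroup X]
    [InnerProductSpace 𝕜 X] (φ : ℕ → X) (r : ℕ) (x : X) : X :=
  ∑ k ∈ Finset.range r, inner 𝕜 (φ k) x • φ k

/-- `P` is a bounded, not necessarily orthogonal, projection with range `U`. -/
def IsProjectionOnto {𝕜 : Type*} [RCLike 𝕜] {V : Type*} [NormedAddCommGroup V]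
    [InnerProductSpace 𝕜 V] (P : V →L[𝕜] V) (U : Submodule 𝕜 V) : Prop :=
  P ∘L P = P ∧ P.range = U

/-- `∑ⱼ ‖vⱼ‖²` in `L²(O; V)`, as an extended nonnegative number. -/
noncomputable def sumNormSq {d m : ℕ} (O : Set (EuclideanSpace ℝ (Fin d))) {V : Type*}
    [NormedAddCommGroup V] (v : Fin m → EuclideanSpace ℝ (Fin d) → V) : ℝ≥0∞ :=
  ∑ j, eLpNorm (v j) 2 (leb O) ^ 2

section Assumptions

variable {𝕜 : Type*} [RCLike 𝕜]
variable {X : Type*} [NormedAddCommGroup X] [InnerProductSpace 𝕜 X]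
  [NormedSpace ℝ X] [IsScalarTower ℝ 𝕜 X]
variable {Y : Type*} [NormedAddCommGroup Y] [InnerProductSpace 𝕜 Y]
  [NormedSpace ℝ Y] [IsScalarTower ℝ 𝕜 Y]
variable {d m : ℕ} {O : Set (EuclideanSpace ℝ (Fin d))}

/-- Standing assumption on the operator and the data: `L wⱼ ∈ L²(O; Y)`, and for all `f ∈ S`
one has `K f ∈ D(L)` and `L K f = ∑ⱼ ∫_O fⱼ(t) L wⱼ(t) dt`. -/
structure MainAssumption (L : X →ₗ.[𝕜] Y) (w : Fin m → L2 O X) : Prop where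
  ae_mem : ∀ j, ∀ᵐ t ∂(leb O), w j t ∈ L.domain
  memLp : ∀ j, MemLp (fun t => val L (w j t)) 2 (leb O)
  mem : ∀ f : S 𝕜 m O, podOperator w f ∈ L.domain
  apply_eq : ∀ f : S 𝕜 m O,
    val L (podOperator w f) = ∑ j, ∫ t in O, f t j • val L (w j t)

/-- The operator `L⁻¹ Π L` (defined on `D(L)` when `L` is injective and `Π` maps into the range
of `L`). -/
noncomputable def invConj (L : X →ₗ.[𝕜] Y) (P : Y →L[𝕜] Y) (x : X) : X :=
  val L.inverse (P (val L x))

/-- The `L⁻¹` assumption for the projection `P = Π_r^Y`: either `s_X < ∞`, or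
`L⁻¹ P L K f = ∑ⱼ ∫_O fⱼ(t) L⁻¹ P L wⱼ(t) dt` for all `f ∈ S`. -/
def InverseAssumption (L : X →ₗ.[𝕜] Y) (w : Fin m → L2 O X) (P : Y →L[𝕜] Y) : Prop :=
  podRank 𝕜 w < ⊤ ∨
    ∀ f : S 𝕜 m O, invConj L P (podOperator w f) = ∑ j, ∫ t in O, f t j • invConj L P (w j t)

/-- `Y_r = L X_r = span {L φ_k : k ≤ r}`. -/
noncomputable def modeSpan (L : X →ₗ.[𝕜] Y) (φ : ℕ → X) (r : ℕ) : Submodule 𝕜 Y :=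
  Submodule.span 𝕜 ((fun k => val L (φ k)) '' Set.Iio r)

end Assumptions

end POD

/-! For square-integrable `u_1, …, u_m`, the sum of the squared norms is the squared Hilbert–Schmidt
norm of the operator `g ↦ ∑ⱼ ∫ gⱼ uⱼ` (`sum_eLpNorm_sq_eq_tsum_hilbertBasis`), computable in any
Hilbert basis of `S`. Take a basis extending the right singular vectors `f_k` with `σ_k > 0`. If the
operator sends these to `σ_k ψ_k` and kills their orthogonal complement (`IsExpansion`), the sum
equals `∑ σ_k² ‖ψ_k‖²`.

The data have such an expansion with `ψ_k = φ_k`, and so does `L w` with `ψ_k = L φ_k`, because its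
operator is `L K`. Each error has the form `u - B v` with `u`, `v` among these two families and `B`
bounded: although `L` and `L⁻¹` may be unbounded, `L Π_r^X` and `L⁻¹ Π_r^Y` factor through
finite-dimensional spaces. Hence the errors again have expansions (`IsExpansion.sub_clm`), whose
first `r` modes vanish by the projection property; this gives the error formulas.

For the convergence, the errors are bounded mode by mode by a constant times the expansion of `L w`
or of `w`, whose total is finite, so the tails tend to zero. -/

namespace POD

/-- Parseval's identity, with extended nonnegative values. -/
theorem enorm_sq_eq_tsum_enorm_inner_sq {ι 𝕜 E : Type*} [RCLike 𝕜] [NormedAddCommGroup E]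
    [InnerProductSpace 𝕜 E] (b : HilbertBasis ι 𝕜 E) (x : E) :
    ‖x‖ₑ ^ 2 = ∑' i, ‖inner 𝕜 (b i) x‖ₑ ^ 2 := by
  have h : HasSum (fun i => ‖inner 𝕜 (b i) x‖ ^ 2) (‖x‖ ^ 2) := by
    have h1 := RCLike.hasSum_re 𝕜 (b.hasSum_inner_mul_inner x x)
    rw [inner_self_eq_norm_sq] at h1
    refine h1.congr_fun fun i => ?_
    rw [← inner_conj_symm (b i) x, RCLike.mul_conj, RCLike.norm_conj]
    norm_cast
  have h2 := ENNReal.ofReal_tsum_of_nonneg (fun i => by positivity) h.summable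
  rw [h.tsum_eq] at h2
  simpa only [ENNReal.ofReal_pow (norm_nonneg _), ofReal_norm] using h2

/-- An orthonormal set in a separable inner product space is countable. -/
theorem countable_of_orthonormal {𝕜 E : Type*} [RCLike 𝕜] [NormedAddCommGroup E]
    [InnerProductSpace 𝕜 E] [TopologicalSpace.SeparableSpace E] {s : Set E}
    (hs : Orthonormal 𝕜 ((↑) : s → E)) : s.Countable := by
  -- Distinct orthonormal vectors are at distance `√2 > 1`, so balls of radius `1 / 2` around them
  -- are disjoint, and a separable space has only countably many disjoint nonempty open sets.
  refine Set.PairwiseDisjoint.countable_of_isOpen (s := fun x => Metric.ball x (1 / 2)) ?_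
    (fun _ _ => Metric.isOpen_ball) (fun x _ => ⟨x, by simp⟩)
  intro x hx y hy hxy
  refine Metric.ball_disjoint_ball ?_
  have h0 : inner 𝕜 x y = 0 := hs.2 (i := ⟨x, hx⟩) (j := ⟨y, hy⟩) (by simpa using hxy)
  have h1 : ‖x - y‖ * ‖x - y‖ = ‖x‖ * ‖x‖ + ‖y‖ * ‖y‖ := by
    have := norm_add_mul_self (𝕜 := 𝕜) x (-y)
    simpa [h0, ← sub_eq_add_neg] using this
  have hx1 : ‖x‖ = 1 := hs.1 ⟨x, hx⟩
  have hy1 : ‖y‖ = 1 := hs.1 ⟨y, hy⟩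
  rw [dist_eq_norm]
  rw [hx1, hy1] at h1
  nlinarith [norm_nonneg (x - y)]

/-! ### Hilbert–Schmidt norm of a synthesis operator. -/

section HilbertSchmidt

variable {α ι 𝕜 V : Type*} [Fintype ι] [RCLike 𝕜] {mα : MeasurableSpace α} {μ : Measure α}
  [NormedAddCommGroup V]

theorem eLpNorm_two_sq {W : Type*} [NormedAddCommGroup W] (u : α → W) :
    eLpNorm u 2 μ ^ 2 = ∫⁻ t, ‖u t‖ₑ ^ 2 ∂μ := by
  have := eLpNorm_nnreal_pow_eq_lintegral (μ := μ) (f := u) (p := 2) two_ne_zero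
  simpa using this

theorem integrable_coord_smul [NormedSpace 𝕜 V] {u : α → V} (hu : MemLp u 2 μ)
    (f : Lp (EuclideanSpace 𝕜 ι) 2 μ) (j : ι) : Integrable (fun t => f t j • u t) μ := by
  have h1 : MemLp (fun t => f t j) 2 μ := by
    refine (Lp.memLp f).of_le ?_ (Eventually.of_forall fun t => PiLp.norm_apply_le (f t) j)
    exact (EuclideanSpace.proj (𝕜 := 𝕜) j).continuous.comp_aestronglyMeasurable
      (Lp.aestronglyMeasurable f)
  exact memLp_one_iff_integrable.1 (hu.smul h1)

/-- The operator `f ↦ ∑ⱼ ∫ fⱼ uⱼ` of a family of functions. -/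
noncomputable def synthesis [NormedSpace 𝕜 V] [NormedSpace ℝ V] (u : ι → α → V)
    (f : Lp (EuclideanSpace 𝕜 ι) 2 μ) : V :=
  ∑ j, ∫ t, f t j • u j t ∂μ

variable [InnerProductSpace 𝕜 V]

/-- This function represents the adjoint of the synthesis operator applied to `v`. -/
theorem memLp_inner_family {u : ι → α → V} (hu : ∀ j, MemLp (u j) 2 μ) (v : V) :
    MemLp (fun t => WithLp.toLp 2 fun j => inner 𝕜 (u j t) v : α → EuclideanSpace 𝕜 ι) 2 μ := by
  refine MemLp.of_eval_piLp fun j => ?_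
  exact (hu j).inner_const v

/-- The adjoint of the synthesis operator. -/
theorem inner_synthesis [CompleteSpace V] [NormedSpace ℝ V] {u : ι → α → V}
    (hu : ∀ j, MemLp (u j) 2 μ) (v : V) (f : Lp (EuclideanSpace 𝕜 ι) 2 μ) :
    inner 𝕜 ((memLp_inner_family (𝕜 := 𝕜) hu v).toLp _) f = inner 𝕜 v (synthesis u f) := by
  have h : ∀ j, inner 𝕜 v (∫ t, f t j • u j t ∂μ) = ∫ t, f t j * inner 𝕜 v (u j t) ∂μ := by
    intro j
    have := ContinuousLinearMap.integral_comp_comm (innerSL 𝕜 v)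
      (integrable_coord_smul (hu j) f j)
    simpa [inner_smul_right] using this.symm
  have hint : ∀ j, Integrable (fun t => f t j * inner 𝕜 v (u j t)) μ := by
    intro j
    have := (innerSL 𝕜 v).integrable_comp (integrable_coord_smul (hu j) f j)
    simpa [inner_smul_right] using this
  rw [synthesis, inner_sum]
  simp_rw [h]
  rw [← integral_finsetSum _ fun j _ => hint j, L2.inner_def]
  refine integral_congr_ae ?_
  filter_upwards [(memLp_inner_family (𝕜 := 𝕜) hu v).coeFn_toLp] with t ht
  rw [ht, PiLp.inner_apply]
  refine Finset.sum_congr rfl fun j _ => ?_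
  simp

/-- The sum of the squared norms of the functions `uⱼ` is the squared Hilbert–Schmidt norm of
their synthesis operator, computed in an arbitrary Hilbert basis. -/
theorem sum_eLpNorm_sq_eq_tsum_hilbertBasis [CompleteSpace V] [NormedSpace ℝ V]
    [TopologicalSpace.SeparableSpace V] {u : ι → α → V} (hu : ∀ j, MemLp (u j) 2 μ) {κ : Type*}
    (b : HilbertBasis κ 𝕜 (Lp (EuclideanSpace 𝕜 ι) 2 μ)) :
    ∑ j, eLpNorm (u j) 2 μ ^ 2 = ∑' k, ‖synthesis u (b k)‖ₑ ^ 2 := by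
  obtain ⟨s, v, hv⟩ := exists_hilbertBasis 𝕜 V
  -- Countability of the basis of `V` permits exchanging the sum with the integral over `t`.
  have hs : s.Countable := countable_of_orthonormal (𝕜 := 𝕜) (hv ▸ v.orthonormal)
  have := hs.to_subtype
  have h1 : ∀ j, eLpNorm (u j) 2 μ ^ 2 = ∑' i, ∫⁻ t, ‖inner 𝕜 (v i) (u j t)‖ₑ ^ 2 ∂μ := by
    intro j
    rw [eLpNorm_two_sq, ← lintegral_tsum]
    · exact lintegral_congr fun t => enorm_sq_eq_tsum_enorm_inner_sq v _
    · intro i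
      exact ((hu j).const_inner (𝕜 := 𝕜) (v i)).aestronglyMeasurable.enorm.pow_const 2
  -- For fixed `i`, the left side is the squared norm of the adjoint at `v i`; Parseval in the basis
  -- `b` and adjointness give the right side.
  have h2 : ∀ i, ∑ j, ∫⁻ t, ‖inner 𝕜 (v i) (u j t)‖ₑ ^ 2 ∂μ =
      ∑' k, ‖inner 𝕜 (v i) (synthesis u (b k))‖ₑ ^ 2 := by
    intro i
    have h3 := enorm_sq_eq_tsum_enorm_inner_sq b ((memLp_inner_family (𝕜 := 𝕜) hu (v i)).toLp _)
    have h4 : ∀ k, ‖inner 𝕜 (b k) ((memLp_inner_family (𝕜 := 𝕜) hu (v i)).toLp _)‖ₑ =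
        ‖inner 𝕜 (v i) (synthesis u (b k))‖ₑ := by
      intro k
      rw [← inner_synthesis hu, ← ofReal_norm, ← ofReal_norm, norm_inner_symm]
    simp_rw [h4] at h3
    rw [← h3, Lp.enorm_toLp, eLpNorm_two_sq, ← lintegral_finsetSum' _ fun j _ =>
      ((hu j).const_inner (𝕜 := 𝕜) (v i)).aestronglyMeasurable.enorm.pow_const 2]
    refine lintegral_congr fun t => ?_
    simp only [← ofReal_norm, ← ENNReal.ofReal_pow (norm_nonneg _)]
    rw [EuclideanSpace.norm_sq_eq, ENNReal.ofReal_sum_of_nonneg fun j _ => by positivity]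
    simp only [norm_inner_symm]
  simp_rw [h1]
  rw [← Summable.tsum_finsetSum fun j _ => ENNReal.summable]
  simp_rw [h2]
  rw [ENNReal.tsum_comm]
  simp_rw [← enorm_sq_eq_tsum_enorm_inner_sq v]

/-- The squared Hilbert–Schmidt norm of a synthesis operator, computed in an orthonormal family
whose orthogonal complement is annihilated by the operator. -/
theorem sum_eLpNorm_sq_eq_tsum [CompleteSpace V] [NormedSpace ℝ V]
    [TopologicalSpace.SeparableSpace V] {u : ι → α → V} (hu : ∀ j, MemLp (u j) 2 μ) {κ : Type*}
    {e : κ → Lp (EuclideanSpace 𝕜 ι) 2 μ} (he : Orthonormal 𝕜 e)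
    (h0 : ∀ g, (∀ k, inner 𝕜 (e k) g = 0) → synthesis u g = 0) :
    ∑ j, eLpNorm (u j) 2 μ ^ 2 = ∑' k, ‖synthesis u (e k)‖ₑ ^ 2 := by
  obtain ⟨s, b, hs, hb⟩ := he.toSubtypeRange.exists_hilbertBasis_extension
  have hzero : ∀ x ∈ s, x ∉ Set.range e → synthesis u x = 0 := by
    intro x hx hxe
    refine h0 x fun k => ?_
    have := b.orthonormal.2 (i := ⟨e k, hs ⟨k, rfl⟩⟩) (j := ⟨x, hx⟩)
      (fun h => hxe ⟨k, congrArg Subtype.val h⟩)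
    simpa [hb] using this
  -- Both sums become sums of indicators over the whole space, to be compared pointwise: basis
  -- vectors outside the family are orthogonal to it and contribute zero.
  rw [sum_eLpNorm_sq_eq_tsum_hilbertBasis hu b, hb,
    ← tsum_range (fun x => ‖synthesis u x‖ₑ ^ 2) he.linearIndependent.injective,
    tsum_subtype s fun x => ‖synthesis u x‖ₑ ^ 2,
    tsum_subtype (Set.range e) fun x => ‖synthesis u x‖ₑ ^ 2]
  congr 1
  ext x
  by_cases hxe : x ∈ Set.range e
  · rw [Set.indicator_of_mem hxe, Set.indicator_of_mem (hs hxe)]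
  · rw [Set.indicator_of_notMem hxe]
    by_cases hx : x ∈ s
    · rw [Set.indicator_of_mem hx, hzero x hx hxe]
      simp
    · rw [Set.indicator_of_notMem hx]

end HilbertSchmidt

/-! ### Partially defined operators extended by zero. -/

section Val

variable {𝕜 V W : Type*} [RCLike 𝕜] [NormedAddCommGroup V] [Module 𝕜 V]
  [NormedAddCommGroup W] [Module 𝕜 W] (T : V →ₗ.[𝕜] W)

theorem val_of_mem {x : V} (h : x ∈ T.domain) : val T x = T ⟨x, h⟩ := by
  simp [val, h]

theorem val_smul (c : 𝕜) {x : V} (h : x ∈ T.domain) : val T (c • x) = c • val T x := by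
  rw [val_of_mem T h, val_of_mem T (T.domain.smul_mem c h), ← T.map_smul]
  rfl

theorem val_add {x y : V} (hx : x ∈ T.domain) (hy : y ∈ T.domain) :
    val T (x + y) = val T x + val T y := by
  rw [val_of_mem T hx, val_of_mem T hy, val_of_mem T (T.domain.add_mem hx hy), ← T.map_add]
  rfl

theorem val_sub {x y : V} (hx : x ∈ T.domain) (hy : y ∈ T.domain) :
    val T (x - y) = val T x - val T y := by
  rw [val_of_mem T hx, val_of_mem T hy, val_of_mem T (T.domain.sub_mem hx hy), ← T.map_sub]
  rfl

theorem val_zero : val T 0 = 0 := by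
  simpa using val_smul T 0 T.domain.zero_mem

theorem val_sum {ι : Type*} (s : Finset ι) {x : ι → V} (h : ∀ i ∈ s, x i ∈ T.domain) :
    val T (∑ i ∈ s, x i) = ∑ i ∈ s, val T (x i) := by
  classical
  induction s using Finset.induction_on with
  | empty => simpa using val_zero T
  | insert a s ha ih =>
    have h' : ∀ i ∈ s, x i ∈ T.domain := fun i hi => h i (Finset.mem_insert_of_mem hi)
    rw [Finset.sum_insert ha, Finset.sum_insert ha,
      val_add T (h a (Finset.mem_insert_self a s)) (T.domain.sum_mem h'), ih h']

theorem val_mem_inverse_domain {x : V} (hx : x ∈ T.domain) : val T x ∈ T.inverse.domain := by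
  rw [LinearPMap.inverse_domain, val_of_mem T hx]
  exact ⟨⟨x, hx⟩, rfl⟩

theorem val_inverse_val (hT : LinearMap.ker T.toFun = ⊥) {x : V} (hx : x ∈ T.domain) :
    val T.inverse (val T x) = x := by
  rw [val_of_mem _ (val_mem_inverse_domain T hx)]
  exact LinearPMap.inverse_apply_eq hT (x := ⟨x, hx⟩) (val_of_mem T hx).symm

end Val

/-! ### Consequences of the singular value decomposition. -/

section SVD

variable {𝕜 V W : Type*} [RCLike 𝕜] [NormedAddCommGroup V] [InnerProductSpace 𝕜 V]
  [NormedAddCommGroup W] [InnerProductSpace 𝕜 W] {T : V →ₗ[𝕜] W} {σ : ℕ → ℝ} {f : ℕ → V}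
  {φ : ℕ → W}

theorem IsSVD.apply_right (h : IsSVD T σ f φ) {k : ℕ} (hk : 0 < σ k) :
    T (f k) = (σ k : 𝕜) • φ k := by
  refine (h.hasSum (f k)).unique ?_
  have h1 := hasSum_single (f := fun i => ((σ i : 𝕜) * inner 𝕜 (f i) (f k)) • φ i) k (by
    intro i hi
    rcases (h.nonneg i).eq_or_lt with h0 | h0
    · simp [← h0]
    · have : inner 𝕜 (f i) (f k) = 0 :=
        h.orthonormal_right.2 (i := ⟨i, h0⟩) (j := ⟨k, hk⟩) (by simpa using hi)
      simp [this])
  have h2 : ‖f k‖ = 1 := h.orthonormal_right.1 ⟨k, hk⟩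
  simpa [inner_self_eq_norm_sq_to_K, h2] using h1

theorem IsSVD.apply_eq_zero (h : IsSVD T σ f φ) {g : V}
    (hg : ∀ k, 0 < σ k → inner 𝕜 (f k) g = 0) : T g = 0 := by
  refine (h.hasSum g).unique ?_
  convert hasSum_zero (α := W) (β := ℕ) using 2 with k
  rcases (h.nonneg k).eq_or_lt with h0 | h0
  · simp [← h0]
  · simp [hg k h0]

theorem IsSVD.inner_left (h : IsSVD T σ f φ) {i k : ℕ} (hi : 0 < σ i) (hk : 0 < σ k) :
    inner 𝕜 (φ i) (φ k) = if i = k then 1 else 0 := by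
  simpa using orthonormal_iff_ite.1 h.orthonormal_left ⟨i, hi⟩ ⟨k, hk⟩

theorem IsSVD.pos_of_lt (h : IsSVD T σ f φ) {r k : ℕ} (hr : 0 < σ (r - 1)) (hk : k < r) :
    0 < σ k :=
  hr.trans_le (h.antitone (by omega))

theorem IsSVD.projX_left (h : IsSVD T σ f φ) {r k : ℕ} (hr : 0 < σ (r - 1)) (hk : 0 < σ k) :
    projX 𝕜 φ r (φ k) = if k < r then φ k else 0 := by
  have h1 : ∀ i ∈ Finset.range r, inner 𝕜 (φ i) (φ k) • φ i = if i = k then φ k else 0 := by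
    intro i hi
    rw [h.inner_left (h.pos_of_lt hr (Finset.mem_range.1 hi)) hk]
    split_ifs with hik <;> simp [hik]
  rw [projX, Finset.sum_congr rfl h1]
  simp

/-- An operator of infinite rank has infinitely many positive singular values. -/
theorem IsSVD.pos_of_rank_eq_top (h : IsSVD T σ f φ)
    (hT : Cardinal.toENat (LinearMap.rank T) = ⊤) (k : ℕ) : 0 < σ k := by
  -- If `σ k` vanished, so would all later singular values, and the range would lie in the span of
  -- `φ 0, …, φ (k - 1)`.
  by_contra hk
  have h0 : ∀ i, i ∉ Finset.range k → σ i = 0 := fun i hi =>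
    le_antisymm ((h.antitone (not_lt.1 (by simpa using hi))).trans (not_lt.1 hk)) (h.nonneg i)
  have hle : LinearMap.range T ≤ Submodule.span 𝕜 (φ '' Set.Iio k) := by
    rintro _ ⟨g, rfl⟩
    rw [(h.hasSum g).unique (hasSum_sum_of_ne_finset_zero (s := Finset.range k) fun i hi => by
      simp [h0 i hi])]
    exact Submodule.sum_mem _ fun i hi => Submodule.smul_mem _ _
      (Submodule.subset_span ⟨i, by simpa using hi, rfl⟩)
  have : FiniteDimensional 𝕜 (Submodule.span 𝕜 (φ '' Set.Iio k)) :=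
    FiniteDimensional.span_of_finite 𝕜 ((Set.finite_Iio k).image φ)
  have : FiniteDimensional 𝕜 (LinearMap.range T) := Submodule.finiteDimensional_of_le hle
  exact (Cardinal.toENat_eq_top.1 hT).not_gt (Module.rank_lt_aleph0 𝕜 (LinearMap.range T))

end SVD

/-! ### Mode expansions, their error sums and tails. -/

section Expansion

variable {𝕜 : Type*} [RCLike 𝕜] {d m : ℕ} {O : Set (EuclideanSpace ℝ (Fin d))}
  {V : Type*} [NormedAddCommGroup V] [InnerProductSpace 𝕜 V] [NormedSpace ℝ V]
  {W : Type*} [NormedAddCommGroup W] [InnerProductSpace 𝕜 W] [NormedSpace ℝ W]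
  {σ : ℕ → ℝ} {f : ℕ → S 𝕜 m O}

/-- The synthesis operator of `u` is `g ↦ ∑ₖ σₖ (g, fₖ) ψₖ`. -/
structure IsExpansion (σ : ℕ → ℝ) (f : ℕ → S 𝕜 m O)
    (u : Fin m → EuclideanSpace ℝ (Fin d) → V) (ψ : ℕ → V) : Prop where
  memLp : ∀ j, MemLp (u j) 2 (leb O)
  apply_eq : ∀ k, 0 < σ k → synthesis u (f k) = (σ k : 𝕜) • ψ k
  apply_eq_zero : ∀ g, (∀ k, 0 < σ k → inner 𝕜 (f k) g = 0) → synthesis u g = 0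

theorem IsExpansion.congr {u u' : Fin m → EuclideanSpace ℝ (Fin d) → V} {ψ ψ' : ℕ → V}
    (h : IsExpansion σ f u ψ) (hu : u = u') (hψ : ∀ k, 0 < σ k → ψ k = ψ' k) :
    IsExpansion σ f u' ψ' := by
  subst hu
  exact ⟨h.memLp, fun k hk => by rw [h.apply_eq k hk, hψ k hk], h.apply_eq_zero⟩

theorem synthesis_sub_clm [CompleteSpace V] [CompleteSpace W]
    {u : Fin m → EuclideanSpace ℝ (Fin d) → V} {v : Fin m → EuclideanSpace ℝ (Fin d) → W}
    (hu : ∀ j, MemLp (u j) 2 (leb O)) (hv : ∀ j, MemLp (v j) 2 (leb O)) (B : W →L[𝕜] V)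
    (g : S 𝕜 m O) :
    synthesis (fun j t => u j t - B (v j t)) g = synthesis u g - B (synthesis v g) := by
  simp only [synthesis, map_sum, ← Finset.sum_sub_distrib]
  refine Finset.sum_congr rfl fun j _ => ?_
  rw [← B.integral_comp_comm (integrable_coord_smul (hv j) g j),
    ← integral_sub (integrable_coord_smul (hu j) g j)
      (B.integrable_comp (integrable_coord_smul (hv j) g j))]
  simp [smul_sub]

/-- Bounded operators commute with the Bochner integral, so expansions are stable under the
operation that produces every error function. -/
theorem IsExpansion.sub_clm [CompleteSpace V] [CompleteSpace W]
    {u : Fin m → EuclideanSpace ℝ (Fin d) → V} {v : Fin m → EuclideanSpace ℝ (Fin d) → W}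
    {ψ : ℕ → V} {χ : ℕ → W} (hu : IsExpansion σ f u ψ) (hv : IsExpansion σ f v χ)
    (B : W →L[𝕜] V) :
    IsExpansion σ f (fun j t => u j t - B (v j t)) fun k => ψ k - B (χ k) where
  memLp j := (hu.memLp j).sub (B.comp_memLp' (hv.memLp j))
  apply_eq k hk := by
    rw [synthesis_sub_clm hu.memLp hv.memLp, hu.apply_eq k hk, hv.apply_eq k hk, map_smul,
      smul_sub]
  apply_eq_zero g hg := by
    rw [synthesis_sub_clm hu.memLp hv.memLp, hu.apply_eq_zero g hg, hv.apply_eq_zero g hg,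
      map_zero, sub_zero]

variable [CompleteSpace V] [TopologicalSpace.SeparableSpace V]
  {u : Fin m → EuclideanSpace ℝ (Fin d) → V} {ψ : ℕ → V}

theorem IsExpansion.sumNormSq_eq (h : IsExpansion σ f u ψ) (hσ : ∀ k, 0 ≤ σ k)
    (hf : Orthonormal 𝕜 (fun k : {k : ℕ // 0 < σ k} => f k)) :
    sumNormSq O u = ∑' k, ENNReal.ofReal (σ k ^ 2 * ‖ψ k‖ ^ 2) := by
  rw [sumNormSq, sum_eLpNorm_sq_eq_tsum (𝕜 := 𝕜) h.memLp hf
    fun g hg => h.apply_eq_zero g fun k hk => hg ⟨k, hk⟩]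
  -- Indices with `σ k = 0` contribute nothing, whatever the arbitrary vector `ψ k` is.
  rw [← tsum_subtype_eq_of_support_subset (s := {k | 0 < σ k})]
  · refine tsum_congr fun k => ?_
    rw [h.apply_eq k k.2, ← ofReal_norm, ← ENNReal.ofReal_pow (norm_nonneg _), norm_smul, mul_pow]
    simp
  · intro k hk
    refine (hσ k).lt_of_ne fun h0 => hk ?_
    simp [← h0]

theorem IsExpansion.sumNormSq_eq_tail (h : IsExpansion σ f u ψ) (hσ : ∀ k, 0 ≤ σ k)
    (hf : Orthonormal 𝕜 (fun k : {k : ℕ // 0 < σ k} => f k)) {r : ℕ}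
    (h0 : ∀ k < r, ψ k = 0) :
    sumNormSq O u = ∑' i, ENNReal.ofReal (σ (r + i) ^ 2 * ‖ψ (r + i)‖ ^ 2) := by
  rw [h.sumNormSq_eq hσ hf, ← ENNReal.summable.sum_add_tsum_nat_add' (k := r),
    Finset.sum_eq_zero fun k hk => by simp [h0 k (Finset.mem_range.1 hk)], zero_add]
  simp_rw [add_comm]

/-- The full series is the sum of finitely many squared `L²` norms, hence finite. -/
theorem IsExpansion.tendsto_tail (h : IsExpansion σ f u ψ) (hσ : ∀ k, 0 ≤ σ k)
    (hf : Orthonormal 𝕜 (fun k : {k : ℕ // 0 < σ k} => f k)) :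
    Tendsto (fun r => ∑' i, ENNReal.ofReal (σ (r + i) ^ 2 * ‖ψ (r + i)‖ ^ 2)) atTop (𝓝 0) := by
  have hfin : ∑' k, ENNReal.ofReal (σ k ^ 2 * ‖ψ k‖ ^ 2) ≠ ∞ := by
    rw [← h.sumNormSq_eq hσ hf, sumNormSq]
    exact ENNReal.sum_ne_top.2 fun j _ => ENNReal.pow_ne_top (h.memLp j).2.ne
  simpa only [add_comm] using ENNReal.tendsto_sum_nat_add _ hfin

/-- Tails of a mode expansion control errors that are dominated mode by mode. -/
theorem IsExpansion.tendsto_of_le (h : IsExpansion σ f u ψ) (hσ : ∀ k, 0 ≤ σ k)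
    (hf : Orthonormal 𝕜 (fun k : {k : ℕ // 0 < σ k} => f k)) {V' : Type*}
    [NormedAddCommGroup V'] {F : ℕ → ℝ≥0∞} {χ : ℕ → ℕ → V'} (C : ℝ)
    (hF : ∀ r, 0 < r → F r = ∑' i, ENNReal.ofReal (σ (r + i) ^ 2 * ‖χ r (r + i)‖ ^ 2))
    (hχ : ∀ r k, 0 < r → ‖χ r k‖ ≤ C * ‖ψ k‖) :
    Tendsto F atTop (𝓝 0) := by
  have h1 := ENNReal.Tendsto.const_mul (a := ENNReal.ofReal (C ^ 2)) (h.tendsto_tail hσ hf)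
    (Or.inr ENNReal.ofReal_ne_top)
  rw [mul_zero] at h1
  refine tendsto_of_tendsto_of_tendsto_of_le_of_le' tendsto_const_nhds h1
    (Eventually.of_forall fun r => zero_le) ?_
  filter_upwards [eventually_gt_atTop 0] with r hr
  rw [hF r hr, ← ENNReal.tsum_mul_left]
  refine ENNReal.tsum_le_tsum fun i => ?_
  rw [← ENNReal.ofReal_mul (sq_nonneg C)]
  refine ENNReal.ofReal_le_ofReal ?_
  calc σ (r + i) ^ 2 * ‖χ r (r + i)‖ ^ 2
      ≤ σ (r + i) ^ 2 * (C * ‖ψ (r + i)‖) ^ 2 := by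
        gcongr
        exact hχ r _ hr
    _ = C ^ 2 * (σ (r + i) ^ 2 * ‖ψ (r + i)‖ ^ 2) := by ring

end Expansion

/-! ### Projections onto mode spans and the operator `L⁻¹ P L`. -/

section Projection

variable {𝕜 : Type*} [RCLike 𝕜]
variable {X : Type*} [NormedAddCommGroup X] [InnerProductSpace 𝕜 X]
variable {Y : Type*} [NormedAddCommGroup Y] [InnerProductSpace 𝕜 Y]
variable {L : X →ₗ.[𝕜] Y} {φ : ℕ → X}

theorem IsProjectionOnto.apply_of_mem {P : Y →L[𝕜] Y} {U : Submodule 𝕜 Y}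
    (hP : IsProjectionOnto P U) {y : Y} (hy : y ∈ U) : P y = y := by
  rw [← hP.2] at hy
  obtain ⟨z, rfl⟩ := hy
  exact DFunLike.congr_fun hP.1 z

theorem IsProjectionOnto.apply_mem {P : Y →L[𝕜] Y} {U : Submodule 𝕜 Y}
    (hP : IsProjectionOnto P U) (y : Y) : P y ∈ U := by
  rw [← hP.2]
  exact ⟨y, rfl⟩

theorem val_mem_modeSpan {r k : ℕ} (hk : k < r) : val L (φ k) ∈ modeSpan L φ r :=
  Submodule.subset_span ⟨k, hk, rfl⟩

/-- A possibly unbounded operator is bounded after a projection onto a finite-dimensional subspace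
of its domain. -/
theorem exists_clm_val_comp_projection {T : Y →ₗ.[𝕜] X} {P : Y →L[𝕜] Y} {U : Submodule 𝕜 Y}
    [FiniteDimensional 𝕜 U] (hP : IsProjectionOnto P U) (hU : U ≤ T.domain) :
    ∃ B : Y →L[𝕜] X, ∀ y, B y = val T (P y) := by
  -- `P` is bounded into `U`, and a linear map on the finite-dimensional space `U` is automatically
  -- continuous.
  refine ⟨(LinearMap.toContinuousLinearMap (T.toFun ∘ₗ Submodule.inclusion hU)).comp
    (P.codRestrict U hP.apply_mem), fun y => ?_⟩
  rw [val_of_mem T (hU (hP.apply_mem y))]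
  rfl

theorem norm_sub_apply_le {P : Y →L[𝕜] Y} {C : ℝ} (hC : ‖P‖ ≤ C) (y : Y) :
    ‖y - P y‖ ≤ (1 + C) * ‖y‖ :=
  calc ‖y - P y‖ ≤ ‖y‖ + ‖P y‖ := norm_sub_le _ _
    _ ≤ ‖y‖ + C * ‖y‖ := by gcongr; exact P.le_of_opNorm_le hC y
    _ = (1 + C) * ‖y‖ := by ring

/-- If `L⁻¹` is bounded by `M`, then `x - L⁻¹ P L x` is bounded by `M (L x - P L x)`. -/
theorem norm_sub_invConj_le (hinj : LinearMap.ker L.toFun = ⊥) {M : ℝ}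
    (hM : ∀ y : L.inverse.domain, ‖L.inverse y‖ ≤ M * ‖(y : Y)‖) {P : Y →L[𝕜] Y}
    {x : X} (hx : x ∈ L.domain) (hPx : P (val L x) ∈ L.inverse.domain) :
    ‖x - invConj L P x‖ ≤ |M| * ‖val L x - P (val L x)‖ := by
  have hy := val_mem_inverse_domain L hx
  have h1 : x - invConj L P x = val L.inverse (val L x - P (val L x)) := by
    rw [val_sub _ hy hPx, val_inverse_val L hinj hx, invConj]
  rw [h1, val_of_mem _ (L.inverse.domain.sub_mem hy hPx)]
  refine (hM _).trans ?_
  gcongr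
  exact le_abs_self M

end Projection

/-! ### Expansions of the data and of the three errors. -/

section Main

variable {𝕜 : Type*} [RCLike 𝕜]
variable {X : Type*} [NormedAddCommGroup X] [InnerProductSpace 𝕜 X]
  [NormedSpace ℝ X] [IsScalarTower ℝ 𝕜 X]
variable {Y : Type*} [NormedAddCommGroup Y] [InnerProductSpace 𝕜 Y]
  [NormedSpace ℝ Y]
variable {d m : ℕ} {O : Set (EuclideanSpace ℝ (Fin d))}
  {w : Fin m → L2 O X} {L : X →ₗ.[𝕜] Y} {σ : ℕ → ℝ} {f : ℕ → S 𝕜 m O} {φ : ℕ → X}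

/-- The POD modes with positive singular values lie in the domain of the operator. -/
theorem MainAssumption.mode_mem (hL : MainAssumption L w)
    (h : IsSVD (podOperator w) σ f φ) {k : ℕ} (hk : 0 < σ k) : φ k ∈ L.domain := by
  have h1 := hL.mem (f k)
  rw [h.apply_right hk] at h1
  exact (L.domain.smul_mem_iff (RCLike.ofReal_ne_zero.2 hk.ne')).1 h1

theorem IsSVD.isExpansion_data (h : IsSVD (podOperator w) σ f φ) :
    IsExpansion σ f (fun j t => w j t) φ where
  memLp j := Lp.memLp (w j)
  apply_eq _ hk := h.apply_right hk
  apply_eq_zero _ hg := h.apply_eq_zero hg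

/-- The assumed exchange of `L` with the integral identifies the synthesis operator of `L w` with `L
K`. -/
theorem MainAssumption.isExpansion (hL : MainAssumption L w)
    (h : IsSVD (podOperator w) σ f φ) :
    IsExpansion σ f (fun j t => val L (w j t)) fun k => val L (φ k) where
  memLp := hL.memLp
  apply_eq k hk := by
    refine (hL.apply_eq (f k)).symm.trans ?_
    rw [h.apply_right hk, val_smul L _ (hL.mode_mem h hk)]
  apply_eq_zero g hg := by
    refine (hL.apply_eq g).symm.trans ?_
    rw [h.apply_eq_zero hg, val_zero]

theorem MainAssumption.isExpansion_projX [CompleteSpace X] [CompleteSpace Y]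
    (hL : MainAssumption L w) (h : IsSVD (podOperator w) σ f φ) {r : ℕ} (hr : 0 < σ (r - 1)) :
    IsExpansion σ f (fun j t => val L (w j t) - val L (projX 𝕜 φ r (w j t)))
      fun k => if k < r then 0 else val L (φ k) := by
  -- `L Π_r^X` written as the finite-rank operator `x ↦ ∑ (φ_k, x) L φ_k`, visibly bounded.
  let B : X →L[𝕜] Y := ∑ k ∈ Finset.range r, (innerSL 𝕜 (φ k)).smulRight (val L (φ k))
  have hB : ∀ x, B x = val L (projX 𝕜 φ r x) := by
    intro x
    have hmem : ∀ k ∈ Finset.range r, φ k ∈ L.domain := fun k hk =>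
      hL.mode_mem h (h.pos_of_lt hr (Finset.mem_range.1 hk))
    rw [projX, val_sum L _ fun k hk => L.domain.smul_mem _ (hmem k hk)]
    rw [sum_apply]
    refine Finset.sum_congr rfl fun k hk => ?_
    rw [val_smul L _ (hmem k hk)]
    simp
  refine ((hL.isExpansion h).sub_clm h.isExpansion_data B).congr ?_ fun k hk => ?_
  · simp_rw [hB]
  · rw [hB, h.projX_left hr hk]
    split_ifs <;> simp [val_zero]

theorem MainAssumption.modeSpan_le (hL : MainAssumption L w)
    (h : IsSVD (podOperator w) σ f φ) {r : ℕ} (hr : 0 < σ (r - 1)) :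
    modeSpan L φ r ≤ L.inverse.domain := by
  refine Submodule.span_le.2 ?_
  rintro _ ⟨k, hk, rfl⟩
  exact val_mem_inverse_domain L (hL.mode_mem h (h.pos_of_lt hr hk))

theorem MainAssumption.isExpansion_invConj [CompleteSpace X] [CompleteSpace Y]
    (hL : MainAssumption L w) (h : IsSVD (podOperator w) σ f φ) {r : ℕ} (hr : 0 < σ (r - 1))
    {P : Y →L[𝕜] Y} (hP : IsProjectionOnto P (modeSpan L φ r)) :
    IsExpansion σ f (fun j t => w j t - invConj L P (w j t))
      fun k => φ k - invConj L P (φ k) := by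
  have : FiniteDimensional 𝕜 (modeSpan L φ r) :=
    FiniteDimensional.span_of_finite 𝕜 ((Set.finite_Iio r).image _)
  obtain ⟨B, hB⟩ := exists_clm_val_comp_projection hP (hL.modeSpan_le h hr)
  refine (h.isExpansion_data.sub_clm (hL.isExpansion h) B).congr ?_ fun k _ => ?_
  · simp_rw [hB, invConj]
  · rw [hB, invConj]

/-- The error formula for `wⱼ - L⁻¹ P L wⱼ`. -/
theorem MainAssumption.error_invConj [CompleteSpace X] [TopologicalSpace.SeparableSpace X]
    [CompleteSpace Y] (hL : MainAssumption L w) (h : IsSVD (podOperator w) σ f φ)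
    (hinj : LinearMap.ker L.toFun = ⊥) {r : ℕ} (hr : 0 < σ (r - 1))
    {P : Y →L[𝕜] Y} (hP : IsProjectionOnto P (modeSpan L φ r)) :
    sumNormSq O (fun j t => w j t - invConj L P (w j t)) =
      ∑' i, ENNReal.ofReal (σ (r + i) ^ 2 * ‖φ (r + i) - invConj L P (φ (r + i))‖ ^ 2) := by
  refine (hL.isExpansion_invConj h hr hP).sumNormSq_eq_tail h.nonneg h.orthonormal_right
    fun k hk => ?_
  rw [invConj, hP.apply_of_mem (val_mem_modeSpan hk),
    val_inverse_val L hinj (hL.mode_mem h (h.pos_of_lt hr hk)), sub_self]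

theorem MainAssumption.error_projX [CompleteSpace X] [CompleteSpace Y]
    [TopologicalSpace.SeparableSpace Y] (hL : MainAssumption L w)
    (h : IsSVD (podOperator w) σ f φ) {r : ℕ} (hr : 0 < σ (r - 1)) :
    sumNormSq O (fun j t => val L (w j t) - val L (projX 𝕜 φ r (w j t))) =
      ∑' i, ENNReal.ofReal (σ (r + i) ^ 2 * ‖val L (φ (r + i))‖ ^ 2) := by
  rw [(hL.isExpansion_projX h hr).sumNormSq_eq_tail h.nonneg h.orthonormal_right
    fun k hk => if_pos hk]
  simp

theorem MainAssumption.error_projection [CompleteSpace Y]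
    [TopologicalSpace.SeparableSpace Y] (hL : MainAssumption L w)
    (h : IsSVD (podOperator w) σ f φ) {r : ℕ}
    {P : Y →L[𝕜] Y} (hP : IsProjectionOnto P (modeSpan L φ r)) :
    sumNormSq O (fun j t => val L (w j t) - P (val L (w j t))) =
      ∑' i, ENNReal.ofReal
        (σ (r + i) ^ 2 * ‖val L (φ (r + i)) - P (val L (φ (r + i)))‖ ^ 2) :=
  ((hL.isExpansion h).sub_clm (hL.isExpansion h) P).sumNormSq_eq_tail h.nonneg
    h.orthonormal_right fun k hk => by
      rw [hP.apply_of_mem (val_mem_modeSpan hk), sub_self]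

end Main

end POD

/-! ### Assembly of the error formulas and the convergence statements. -/

theorem mainTheorem1 {𝕜 : Type*} [RCLike 𝕜]
    {X : Type*} [NormedAddCommGroup X] [InnerProductSpace 𝕜 X] [CompleteSpace X]
    [TopologicalSpace.SeparableSpace X] [NormedSpace ℝ X] [IsScalarTower ℝ 𝕜 X]
    {Y : Type*} [NormedAddCommGroup Y] [InnerProductSpace 𝕜 Y] [CompleteSpace Y]
    [TopologicalSpace.SeparableSpace Y] [NormedSpace ℝ Y] [IsScalarTower ℝ 𝕜 Y]
    {d m : ℕ} (hd : 0 < d) (hm : 0 < m)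
    (O : Set (EuclideanSpace ℝ (Fin d))) (hO : IsOpen O)
    -- `NormedSpace ℝ` is the (unique) real scalar multiplication used by the Bochner integral
    -- the data, the operator and the standing assumption on them
    (w : Fin m → POD.L2 O X) (L : X →ₗ.[𝕜] Y) (hLw : POD.MainAssumption L w)
    -- the POD singular values, right singular vectors, and POD modes
    (σ : ℕ → ℝ) (f : ℕ → POD.S 𝕜 m O) (φ : ℕ → X)
    (hsvd : POD.IsSVD (POD.podOperator w) σ f φ)
    -- projections onto `span {L φ_k : k ≤ r}` for those `r ≥ 1` with positive `r`-th singular value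
    (P : ℕ → Y →L[𝕜] Y)
    (hP : ∀ r, 0 < r → 0 < σ (r - 1) → POD.IsProjectionOnto (P r) (POD.modeSpan L φ r)) :
    -- the first two error formulas
    (∀ r, 0 < r → 0 < σ (r - 1) →
      ((∀ j, MemLp (fun t => POD.val L (w j t) - POD.val L (POD.projX 𝕜 φ r (w j t))) 2
          (POD.leb O)) ∧
        POD.sumNormSq O
            (fun j t => POD.val L (w j t) - POD.val L (POD.projX 𝕜 φ r (w j t))) =
          ∑' i, ENNReal.ofReal (σ (r + i) ^ 2 * ‖POD.val L (φ (r + i))‖ ^ 2)) ∧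
      ((∀ j, MemLp (fun t => POD.val L (w j t) - P r (POD.val L (w j t))) 2 (POD.leb O)) ∧
        POD.sumNormSq O (fun j t => POD.val L (w j t) - P r (POD.val L (w j t))) =
          ∑' i, ENNReal.ofReal
            (σ (r + i) ^ 2 * ‖POD.val L (φ (r + i)) - P r (POD.val L (φ (r + i)))‖ ^ 2))) ∧
    -- the third error formula, for invertible `L`
    (LinearMap.ker L.toFun = ⊥ →
      ∀ r, 0 < r → 0 < σ (r - 1) → POD.InverseAssumption L w (P r) →
        (∀ j, MemLp (fun t => w j t - POD.invConj L (P r) (w j t)) 2 (POD.leb O)) ∧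
        POD.sumNormSq O (fun j t => w j t - POD.invConj L (P r) (w j t)) =
          ∑' i, ENNReal.ofReal
            (σ (r + i) ^ 2 * ‖φ (r + i) - POD.invConj L (P r) (φ (r + i))‖ ^ 2)) ∧
    -- convergence of the errors when `s_X = ∞`
    (POD.podRank 𝕜 w = ⊤ →
      Tendsto (fun r => POD.sumNormSq O
          (fun j t => POD.val L (w j t) - POD.val L (POD.projX 𝕜 φ r (w j t))))
        atTop (𝓝 0) ∧
      ((∃ C : ℝ, ∀ r, 0 < r → ‖P r‖ ≤ C) →
        Tendsto (fun r => POD.sumNormSq O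
            (fun j t => POD.val L (w j t) - P r (POD.val L (w j t))))
          atTop (𝓝 0)) ∧
      (LinearMap.ker L.toFun = ⊥ →
        (((∃ M : ℝ, ∀ y : L.inverse.domain, ‖L.inverse y‖ ≤ M * ‖(y : Y)‖) ∧
            (∃ C : ℝ, ∀ r, 0 < r → ‖P r‖ ≤ C)) ∨
          (∃ C : ℝ, ∀ r, 0 < r → ∀ x ∈ L.domain, ‖POD.invConj L (P r) x‖ ≤ C * ‖x‖)) →
        Tendsto (fun r => POD.sumNormSq O (fun j t => w j t - POD.invConj L (P r) (w j t)))
          atTop (𝓝 0))) := by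
  -- Infinite rank makes every `σ k` positive, so every mode lies in `D(L)` and the error formulas
  -- hold for all `r ≥ 1`.
  have hpos := fun (h : POD.podRank 𝕜 w = ⊤) => hsvd.pos_of_rank_eq_top h
  have hLφ := hLw.isExpansion hsvd
  refine ⟨fun r hr hσ => ⟨⟨(hLw.isExpansion_projX hsvd hσ).memLp, hLw.error_projX hsvd hσ⟩,
      (hLφ.sub_clm hLφ (P r)).memLp, hLw.error_projection hsvd (hP r hr hσ)⟩,
    fun hinj r hr hσ _ => ⟨(hLw.isExpansion_invConj hsvd hσ (hP r hr hσ)).memLp,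
      hLw.error_invConj hsvd hinj hσ (hP r hr hσ)⟩,
    fun hrank => ⟨?_, ?_, fun hinj => ?_⟩⟩
  · refine (hLφ.tendsto_tail hsvd.nonneg hsvd.orthonormal_right).congr fun r => ?_
    exact (hLw.error_projX hsvd (hpos hrank _)).symm
  · rintro ⟨C, hC⟩
    exact hLφ.tendsto_of_le hsvd.nonneg hsvd.orthonormal_right (1 + C)
      (χ := fun r k => POD.val L (φ k) - P r (POD.val L (φ k)))
      (fun r hr => hLw.error_projection hsvd (hP r hr (hpos hrank _)))
      fun r k hr => POD.norm_sub_apply_le (hC r hr) _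
  · have hF := fun r (hr : 0 < r) =>
      hLw.error_invConj hsvd hinj (hpos hrank _) (hP r hr (hpos hrank _))
    rintro (⟨⟨M, hM⟩, C, hC⟩ | ⟨C, hC⟩)
    -- The factor `|M|` comes from `L⁻¹` (the sign of `M` is not prescribed), and `1 + C` from the
    -- bound for `y - P y`.
    · refine hLφ.tendsto_of_le hsvd.nonneg hsvd.orthonormal_right (|M| * (1 + C))
        (χ := fun r k => φ k - POD.invConj L (P r) (φ k)) hF fun r k hr => ?_
      have hPr := hP r hr (hpos hrank _)
      refine (POD.norm_sub_invConj_le hinj hM (hLw.mode_mem hsvd (hpos hrank k))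
        (hLw.modeSpan_le hsvd (hpos hrank _) (hPr.apply_mem _))).trans ?_
      rw [mul_assoc]
      gcongr
      exact POD.norm_sub_apply_le (hC r hr) _
    -- A uniform bound on `L⁻¹ P L` controls the error by `‖φ_k‖` itself, so the comparison series
    -- is that of the data, not of `L w`.
    · refine hsvd.isExpansion_data.tendsto_of_le hsvd.nonneg hsvd.orthonormal_right (1 + C)
        (χ := fun r k => φ k - POD.invConj L (P r) (φ k)) hF fun r k hr => ?_
      have h1 := hC r hr (φ k) (hLw.mode_mem hsvd (hpos hrank k))
      refine (norm_sub_le _ _).trans ?_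
      linarith
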